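/- For $f,g\colon\{-1,1\}^n\to\{0,1\}$, let expectations and $\mathrm{Cov}(f,g)=\mathbb E[fg]-\mathbb E[f]\,\mathbb E[g]$ be taken with respect to the uniform measure on $\{-1,1\}^n$, let $\hat f(\{i\})=\mathbb E[f(x)\,x_i]$ be the first-degree Fourier coefficients, and let $\varphi(x)=x/\log(e/x)$ (natural logarithm, $\varphi(0)=0$). Talagrand's correlation inequality asserts that $\mathrm{Cov}(f,g)\ge c'\,\varphi\bigl(\sum_i\hat f(\{i\})\,\hat g(\{i\})\bigr)$ for any two monotone $f,g$, where $c'>0$ is a universal constant. Corollary. There exist universal constants $c,C>0$ such that the following holds for every $n$, every $a\in\mathbb R^n$ and every $t\in\mathbb R$. Let $f(x)=\mathbb 1\bigl(\sum_i a_ix_i>t\bigr)$ be a halfspace, and let $g(x)=\mathbb 1\bigl(\sum_i a_ix_i\ge -t\bigr)$ be the dual halfspace. Then $$c\,\varphi\Bigl(\sum_{i=1}^n\hat f(\{i\})\,\hat g(\{i\})\Bigr)\;\le\;\mathrm{Cov}(f,g)\;\le\;C\,\varphi\Bigl(\sum_{i=1}^n\hat f(\{i\})\,\hat g(\{i\})\Bigr),$$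 that is, $\mathrm{Cov}(f,g)=\Theta\bigl(\varphi(\sum_i\hat f(\{i\})\hat g(\{i\}))\bigr)$. Moreover, if $a_i\ge 0$ for all $i$, then $f$ and $g$ are monotone (non-decreasing in each coordinate). So such pairs $(f,g)$ are tightness examples for Talagrand's correlation inequality. -/

import Mathlib

namespace BooleanCube

/-- The discrete cube `{-1, 1}^n`; the group of units `ℤˣ` is `{1, -1}`. -/
abbrev Cube (n : ℕ) : Type := Fin n → ℤˣ

/-- The `i`-th coordinate of a point of the cube, as the real number `1` or `-1`. -/
def coord {n : ℕ} (x : Cube n) (i : Fin n) : ℝ := ((x i : ℤ) : ℝ)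

/-- Expectation with respect to the uniform probability measure on the cube. -/
noncomputable def expect {n : ℕ} (f : Cube n → ℝ) : ℝ := (∑ x : Cube n, f x) / 2 ^ n

/-- Covariance with respect to the uniform probability measure on the cube. -/
noncomputable def cov {n : ℕ} (f g : Cube n → ℝ) : ℝ :=
  expect (fun x => f x * g x) - expect f * expect g

/-- The Fourier-Walsh coefficient of `f` at `S`, that is, `E[f(x) x^S]`
with `x^S = ∏_{i ∈ S} x_i`. -/
noncomputable def fourier {n : ℕ} (f : Cube n → ℝ) (S : Finset (Fin n)) : ℝ :=
  expect (fun x => f x * ∏ i ∈ S, coord x i)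

/-- The halfspace `1(∑ a_i x_i > t)`. -/
noncomputable def halfspace {n : ℕ} (a : Fin n → ℝ) (t : ℝ) (x : Cube n) : ℝ :=
  if (∑ i, a i * coord x i) > t then 1 else 0

/-- The dual halfspace `1(∑ a_i x_i ≥ -t)` of `1(∑ a_i x_i > t)`. -/
noncomputable def dualHalfspace {n : ℕ} (a : Fin n → ℝ) (t : ℝ) (x : Cube n) : ℝ :=
  if (∑ i, a i * coord x i) ≥ -t then 1 else 0

/-- The function `φ(x) = x / log(e / x)` of Talagrand's correlation inequality
(natural logarithm). In Lean `φ 0 = 0`, which is its limit at `0`. -/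
noncomputable def talagrandPhi (x : ℝ) : ℝ := x / Real.log (Real.exp 1 / x)

end BooleanCube

/-! Halfspaces and their duals are tight for Talagrand's correlation inequality.

Up to exchanging the two functions, `f` is the one contained in the open half cube where
`S = ∑ aᵢ xᵢ` is positive. As `g x = 1 - f (-x)`, the two functions have the same first-degree
coefficients, and `f ≤ g`, so the covariance is `p ^ 2` with `p = E f`. Let `m = E[x | f = 1]`; the
Fourier sum is `W = p ^ 2 * |m| ^ 2`, and what has to be shown is that `|m| ^ 2` is of order
`1 + log (1 / p)`.

* Upper bound, valid for every Boolean function (`level_one_upper`): by Jensen's inequality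
  `p * exp (|m| ^ 2) ≤ E[f * exp ⟨m, x⟩] ≤ ∏ cosh mᵢ ≤ exp (|m| ^ 2 / 2)`.
* A constant lower bound on `|m|` (`level_one_lower_const`): `f` and the positive part of `S` are
  both monotone functions of `S`, hence `⟨a, m⟩ ≥ E[max S 0] ≥ |a| / 4` by Chebyshev's sum
  inequality and Khinchine's inequality.
* The logarithmic lower bound (`level_one_lower_exp`): tilt the uniform measure to the product
  measure `ν` with density `∏ (1 + θᵢ xᵢ)`, where `θᵢ = mᵢ` if `|mᵢ| < 1/2` and `θᵢ` is the sign of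
  `aᵢ` otherwise. The `ν`-mean of `S` is at least `⟨a, m⟩`, the mean of `S` on `{f = 1}`, so `f = 1`
  wherever `S` is at least its `ν`-mean. Since no `|θᵢ|` lies strictly between `1/2` and `1`, the
  centred sum has a fourth moment controlled by its variance, and it is nonnegative with
  `ν`-probability at least `1/9` (`nonneg_prob`). The Cauchy–Schwarz inequality then gives
  `1 / 81 ≤ p * ∏ (1 + θᵢ ^ 2) ≤ p * exp (4 * |m| ^ 2)`.
-/

namespace BooleanCube

/-! ### Expectation on the cube -/

lemma expect_add {n : ℕ} (f g : Cube n → ℝ) :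
    expect (fun x => f x + g x) = expect f + expect g := by
  simp [expect, Finset.sum_add_distrib, add_div]

lemma expect_sub {n : ℕ} (f g : Cube n → ℝ) :
    expect (fun x => f x - g x) = expect f - expect g := by
  simp [expect, Finset.sum_sub_distrib, sub_div]

lemma expect_const_mul {n : ℕ} (c : ℝ) (f : Cube n → ℝ) :
    expect (fun x => c * f x) = c * expect f := by
  simp [expect, ← Finset.mul_sum, mul_div_assoc]

lemma expect_finset_sum {n : ℕ} {ι : Type*} (s : Finset ι) (f : ι → Cube n → ℝ) :
    expect (fun x => ∑ i ∈ s, f i x) = ∑ i ∈ s, expect (f i) := by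
  simp only [expect, ← Finset.sum_div]
  rw [Finset.sum_comm]

lemma expect_mono {n : ℕ} {f g : Cube n → ℝ} (h : ∀ x, f x ≤ g x) : expect f ≤ expect g := by
  unfold expect
  gcongr with x
  exact h x

lemma expect_nonneg {n : ℕ} {f : Cube n → ℝ} (h : ∀ x, 0 ≤ f x) : 0 ≤ expect f :=
  div_nonneg (Finset.sum_nonneg fun x _ => h x) (by positivity)

lemma expect_one (n : ℕ) : expect (fun _ : Cube n => (1 : ℝ)) = 1 := by
  simp [expect]

lemma eq_zero_of_expect_eq_zero {n : ℕ} {f : Cube n → ℝ} (h : ∀ x, 0 ≤ f x) (h0 : expect f = 0)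
    (x : Cube n) : f x = 0 := by
  have hs : ∑ x, f x = 0 := by
    unfold expect at h0
    have h2 : (2 : ℝ) ^ n ≠ 0 := by positivity
    simpa [h2] using h0
  exact (Finset.sum_eq_zero_iff_of_nonneg fun x _ => h x).1 hs x (Finset.mem_univ x)

lemma expect_neg_arg {n : ℕ} (f : Cube n → ℝ) : expect (fun x => f (-x)) = expect f := by
  unfold expect
  exact congrArg (· / 2 ^ n) (Equiv.sum_comp (Equiv.neg (Cube n)) f)

lemma expect_succ {n : ℕ} (f : Cube (n + 1) → ℝ) :
    expect f = expect fun y : Cube n => (f (Fin.cons 1 y) + f (Fin.cons (-1) y)) / 2 := by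
  unfold expect
  rw [← Equiv.sum_comp (Fin.consEquiv fun _ => ℤˣ) f, Fintype.sum_prod_type]
  have hu : (Finset.univ : Finset ℤˣ) = {1, -1} := by decide
  rw [hu, Finset.sum_pair (by decide), ← Finset.sum_div, Finset.sum_add_distrib, pow_succ',
    div_div]
  rfl

lemma expect_cauchy_schwarz {n : ℕ} (f g : Cube n → ℝ) :
    expect (fun x => f x * g x) ^ 2 ≤ expect (fun x => f x ^ 2) * expect fun x => g x ^ 2 := by
  unfold expect
  rw [div_pow, div_mul_div_comm, ← sq]
  gcongr
  exact Finset.sum_mul_sq_le_sq_mul_sq _ _ _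

lemma expect_prod {n : ℕ} (h : Fin n → ℝ → ℝ) :
    expect (fun x => ∏ i, h i (coord x i)) = ∏ i, (h i 1 + h i (-1)) / 2 := by
  induction n with
  | zero => simp [expect]
  | succ n ih =>
    rw [expect_succ, Fin.prod_univ_succ, ← ih fun i => h i.succ, ← expect_const_mul]
    congr 1
    funext y
    simp [Fin.prod_univ_succ, coord]
    ring

lemma coord_neg {n : ℕ} (x : Cube n) (i : Fin n) : coord (-x) i = -coord x i := by
  simp [coord]

lemma fourier_singleton {n : ℕ} (f : Cube n → ℝ) (i : Fin n) :
    fourier f {i} = expect fun x => f x * coord x i := by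
  simp [fourier]

/-! ### Centred linear forms under a biased product measure -/

/-- The density, with respect to the uniform measure, of the product measure on the cube under
which the `i`-th coordinate has mean `θ i` (a probability density when `|θ i| ≤ 1`). -/
noncomputable def biasedDensity {n : ℕ} (θ : Fin n → ℝ) (x : Cube n) : ℝ :=
  ∏ i, (1 + θ i * coord x i)

/-- The linear form `∑ aᵢ xᵢ`, centred under the measure with coordinate means `θ`. -/
noncomputable def centeredForm {n : ℕ} (a θ : Fin n → ℝ) (x : Cube n) : ℝ :=
  ∑ i, a i * (coord x i - θ i)

lemma biasedDensity_nonneg {n : ℕ} {θ : Fin n → ℝ} (hθ : ∀ i, |θ i| ≤ 1) (x : Cube n) :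
    0 ≤ biasedDensity θ x := by
  refine Finset.prod_nonneg fun i _ => ?_
  have h := abs_le.1 (hθ i)
  rcases Int.units_eq_one_or (x i) with hx | hx <;> simp [coord, hx] <;> linarith

lemma biasedDensity_cons {n : ℕ} (θ : Fin (n + 1) → ℝ) (u : ℤˣ) (y : Cube n) :
    biasedDensity θ (Fin.cons u y : Cube (n + 1)) =
      (1 + θ 0 * ((u : ℤ) : ℝ)) * biasedDensity (fun i => θ i.succ) y := by
  simp [biasedDensity, Fin.prod_univ_succ, coord]

lemma centeredForm_cons {n : ℕ} (a θ : Fin (n + 1) → ℝ) (u : ℤˣ) (y : Cube n) :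
    centeredForm a θ (Fin.cons u y : Cube (n + 1)) =
      a 0 * (((u : ℤ) : ℝ) - θ 0) + centeredForm (fun i => a i.succ) (fun i => θ i.succ) y := by
  simp [centeredForm, Fin.sum_univ_succ, coord]

lemma expect_biasedDensity {n : ℕ} (θ : Fin n → ℝ) : expect (biasedDensity θ) = 1 := by
  have h := expect_prod fun i u => 1 + θ i * u
  refine h.trans (Finset.prod_eq_one fun i _ => ?_)
  ring

lemma expect_biasedDensity_sq {n : ℕ} (θ : Fin n → ℝ) :
    expect (fun x => biasedDensity θ x ^ 2) = ∏ i, (1 + θ i ^ 2) := by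
  have h := expect_prod fun i u => (1 + θ i * u) ^ 2
  simp only [biasedDensity, ← Finset.prod_pow]
  rw [h]
  exact Finset.prod_congr rfl fun i _ => by ring

lemma first_moment {n : ℕ} (a θ : Fin n → ℝ) :
    expect (fun x => biasedDensity θ x * centeredForm a θ x) = 0 := by
  induction n with
  | zero => simp [expect, centeredForm]
  | succ n ih =>
    rw [expect_succ, ← ih (fun i => a i.succ) fun i => θ i.succ]
    congr 1
    funext y
    simp only [biasedDensity_cons, centeredForm_cons]
    push_cast
    ring

lemma second_moment {n : ℕ} (a θ : Fin n → ℝ) :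
    expect (fun x => biasedDensity θ x * centeredForm a θ x ^ 2) =
      ∑ i, a i ^ 2 * (1 - θ i ^ 2) := by
  induction n with
  | zero => simp [expect, centeredForm]
  | succ n ih =>
    rw [expect_succ, Fin.sum_univ_succ, ← ih (fun i => a i.succ) fun i => θ i.succ]
    have h : a 0 ^ 2 * (1 - θ 0 ^ 2) =
        expect fun y => a 0 ^ 2 * (1 - θ 0 ^ 2) * biasedDensity (fun i => θ i.succ) y := by
      rw [expect_const_mul, expect_biasedDensity, mul_one]
    rw [h, ← expect_add]
    congr 1
    funext y
    simp only [biasedDensity_cons, centeredForm_cons]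
    push_cast
    ring

/-- The hypothesis says that each coordinate satisfies the fourth moment bound: for
`z = x - θ` with `x = ±1` of mean `θ`, one has `E z ^ 2 = 1 - θ ^ 2` and
`E z ^ 4 = (1 - θ ^ 2) (1 + 3 θ ^ 2)`. -/
lemma fourth_moment_le {n : ℕ} (a θ : Fin n → ℝ)
    (hθ : ∀ i, (1 - θ i ^ 2) * (1 + 3 * θ i ^ 2) ≤ 3 * (1 - θ i ^ 2) ^ 2) :
    expect (fun x => biasedDensity θ x * centeredForm a θ x ^ 4) ≤
      3 * (∑ i, a i ^ 2 * (1 - θ i ^ 2)) ^ 2 := by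
  induction n with
  | zero => simp [expect, centeredForm]
  | succ n ih =>
    have ih := ih (fun i => a i.succ) (fun i => θ i.succ) fun i => hθ i.succ
    have h1 := first_moment (fun i => a i.succ) fun i => θ i.succ
    have h2 := second_moment (fun i => a i.succ) fun i => θ i.succ
    have h0 := expect_biasedDensity fun i => θ i.succ
    rw [expect_succ, Fin.sum_univ_succ]
    set w := biasedDensity fun i : Fin n => θ i.succ with hw
    set Z := centeredForm (fun i : Fin n => a i.succ) fun i => θ i.succ with hZ
    set V := ∑ i : Fin n, a i.succ ^ 2 * (1 - θ i.succ ^ 2)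
    have key : (expect fun y : Cube n =>
        (biasedDensity θ (Fin.cons 1 y : Cube (n + 1)) *
            centeredForm a θ (Fin.cons 1 y : Cube (n + 1)) ^ 4 +
          biasedDensity θ (Fin.cons (-1) y : Cube (n + 1)) *
            centeredForm a θ (Fin.cons (-1) y : Cube (n + 1)) ^ 4) / 2) =
        expect (fun y => w y * Z y ^ 4) + 6 * (a 0 ^ 2 * (1 - θ 0 ^ 2)) * V +
          a 0 ^ 4 * ((1 - θ 0 ^ 2) * (1 + 3 * θ 0 ^ 2)) := by
      have e : (fun y : Cube n =>
          (biasedDensity θ (Fin.cons 1 y : Cube (n + 1)) *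
              centeredForm a θ (Fin.cons 1 y : Cube (n + 1)) ^ 4 +
            biasedDensity θ (Fin.cons (-1) y : Cube (n + 1)) *
              centeredForm a θ (Fin.cons (-1) y : Cube (n + 1)) ^ 4) / 2) =
          fun y => w y * Z y ^ 4 + 6 * (a 0 ^ 2 * (1 - θ 0 ^ 2)) * (w y * Z y ^ 2) +
            -8 * a 0 ^ 3 * θ 0 * (1 - θ 0 ^ 2) * (w y * Z y) +
            a 0 ^ 4 * ((1 - θ 0 ^ 2) * (1 + 3 * θ 0 ^ 2)) * w y := by
        funext y
        simp only [biasedDensity_cons, centeredForm_cons, ← hw, ← hZ]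
        push_cast
        ring
      rw [e, expect_add, expect_add, expect_add, expect_const_mul, expect_const_mul,
        expect_const_mul, h0, h1, h2]
      ring
    rw [key]
    have h4 := mul_le_mul_of_nonneg_left (hθ 0) (by positivity : 0 ≤ a 0 ^ 4)
    linarith [h4, ih]

/-- A Paley–Zygmund type bound: the fourth moment being at most three times the squared variance,
a centred linear form is nonnegative with probability at least `1 / 9`. -/
lemma nonneg_prob {n : ℕ} (a θ : Fin n → ℝ) (hθ1 : ∀ i, |θ i| ≤ 1)
    (hθ : ∀ i, (1 - θ i ^ 2) * (1 + 3 * θ i ^ 2) ≤ 3 * (1 - θ i ^ 2) ^ 2) (f : Cube n → ℝ)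
    (hf0 : ∀ x, 0 ≤ f x) (hf : ∀ x, 0 ≤ centeredForm a θ x → f x = 1) :
    1 / 9 ≤ expect fun x => biasedDensity θ x * f x := by
  have h0 := expect_biasedDensity θ
  have h1 := first_moment a θ
  have h2 := second_moment a θ
  have h4 := fourth_moment_le a θ hθ
  have hw := biasedDensity_nonneg hθ1
  set V := ∑ i, a i ^ 2 * (1 - θ i ^ 2)
  have hV : 0 ≤ V := h2 ▸ expect_nonneg fun x => mul_nonneg (hw x) (sq_nonneg _)
  rcases hV.eq_or_lt with hV | hV
  · -- The form vanishes on the support of the density.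
    have hz := eq_zero_of_expect_eq_zero (fun x => mul_nonneg (hw x) (sq_nonneg _))
      (h2.trans hV.symm)
    have e : (fun x => biasedDensity θ x * f x) = biasedDensity θ := by
      funext x
      rcases mul_eq_zero.1 (hz x) with h | h
      · rw [h, zero_mul]
      · rw [hf x (pow_eq_zero_iff two_ne_zero |>.1 h).ge, mul_one]
    rw [e, h0]
    norm_num
  · obtain ⟨σ, hσ, hσV⟩ : ∃ σ, 0 < σ ∧ σ ^ 2 = V := ⟨√V, by positivity, Real.sq_sqrt hV.le⟩
    rw [← hσV] at h2 h4
    -- The polynomial `16/5 z + 4 z² - z⁴` is at most `0` for `z < 0` and at most `9` for `z ≥ 0`.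
    have pt : ∀ x, 16 / 5 * σ ^ 3 * (biasedDensity θ x * centeredForm a θ x) +
        4 * σ ^ 2 * (biasedDensity θ x * centeredForm a θ x ^ 2) ≤
        biasedDensity θ x * centeredForm a θ x ^ 4 +
          9 * σ ^ 4 * (biasedDensity θ x * f x) := by
      intro x
      obtain ⟨z, hz⟩ : ∃ z, centeredForm a θ x = σ * z :=
        ⟨centeredForm a θ x / σ, by field_simp⟩
      have hq : 16 / 5 * z + 4 * z ^ 2 ≤ z ^ 4 + 9 * f x := by
        rcases le_or_gt 0 z with h | h
        · rw [hf x (hz ▸ mul_nonneg hσ.le h)]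
          nlinarith [sq_nonneg (z ^ 2 - 5 / 2), sq_nonneg (z - 8 / 5)]
        · have : 0 ≤ 16 / 5 - 4 * (-z) + (-z) ^ 3 := by
            nlinarith [mul_nonneg (neg_pos.2 h).le (sq_nonneg (-z - 23 / 20)),
              sq_nonneg (-z - 23 / 20)]
          nlinarith [mul_nonneg (neg_pos.2 h).le this, hf0 x]
      rw [hz]
      have := mul_le_mul_of_nonneg_left hq (mul_nonneg (hw x) (by positivity : 0 ≤ σ ^ 4))
      linarith
    have := expect_mono pt
    rw [expect_add, expect_add, expect_const_mul, expect_const_mul, expect_const_mul, h1, h2]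
      at this
    have h9 : σ ^ 4 * 1 ≤ σ ^ 4 * (9 * expect fun x => biasedDensity θ x * f x) := by linarith
    have := le_of_mul_le_mul_left h9 (by positivity)
    linarith

/-! ### First-degree Fourier weight -/

/-- Sum of the squares of the first-degree Fourier coefficients. -/
noncomputable def levelOneWeight {n : ℕ} (f : Cube n → ℝ) : ℝ := ∑ i, fourier f {i} ^ 2

lemma expect_mul_linear {n : ℕ} (f : Cube n → ℝ) (b : Fin n → ℝ) :
    (expect fun x => f x * ∑ i, b i * coord x i) = ∑ i, b i * fourier f {i} := by
  simp only [fourier_singleton, Finset.mul_sum]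
  rw [expect_finset_sum]
  refine Finset.sum_congr rfl fun i _ => ?_
  rw [← expect_const_mul]
  congr 1
  funext x
  ring

/-- The level-one inequality, `exp (|m| ^ 2 / 2) ≤ 1 / p` for the conditional mean `m`. -/
lemma level_one_upper {n : ℕ} {f : Cube n → ℝ} (hf : ∀ x, f x = 0 ∨ f x = 1)
    (hp : 0 < expect f) :
    levelOneWeight f ≤ 2 * expect f ^ 2 * Real.log (1 / expect f) := by
  set p := expect f with hpdef
  let m : Fin n → ℝ := fun i => fourier f {i} / p
  let Q := ∑ i, m i ^ 2
  have hW : levelOneWeight f = p ^ 2 * Q := by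
    simp only [levelOneWeight, Q, m, Finset.mul_sum]
    exact Finset.sum_congr rfl fun i _ => by field_simp
  have hmf : (expect fun x => f x * ∑ i, m i * coord x i) = p * Q := by
    rw [expect_mul_linear, Finset.mul_sum]
    exact Finset.sum_congr rfl fun i _ => by simp only [m]; field_simp
  -- Jensen's inequality, through the tangent line of `exp` at `Q`.
  have h1 : Real.exp Q * p ≤ expect fun x => Real.exp (∑ i, m i * coord x i) := by
    have e : Real.exp Q * p =
        expect fun x => Real.exp Q * ((1 - Q) * f x + f x * ∑ i, m i * coord x i) := by
      rw [expect_const_mul, expect_add, expect_const_mul, hmf]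
      ring
    rw [e]
    refine expect_mono fun x => ?_
    rcases hf x with h | h <;> rw [h]
    · simpa using (Real.exp_pos _).le
    · have := Real.add_one_le_exp (∑ i, m i * coord x i - Q)
      have h' := mul_le_mul_of_nonneg_left this (Real.exp_pos Q).le
      rw [← Real.exp_add, add_sub_cancel] at h'
      linarith
  have h2 : (expect fun x => Real.exp (∑ i, m i * coord x i)) ≤ Real.exp (Q / 2) := by
    simp only [Real.exp_sum]
    rw [expect_prod fun i u => Real.exp (m i * u), Finset.sum_div, Real.exp_sum]
    refine Finset.prod_le_prod (fun i _ => by positivity) fun i _ => ?_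
    have := Real.cosh_le_exp_half_sq (m i)
    rw [Real.cosh_eq] at this
    simpa using this
  have h3 : Q / 2 ≤ Real.log (1 / p) := by
    rw [Real.le_log_iff_exp_le (by positivity), le_div_iff₀ hp]
    have h := h1.trans h2
    have hQ : Real.exp Q = Real.exp (Q / 2) * Real.exp (Q / 2) := by
      rw [← Real.exp_add, add_halves]
    rw [hQ, mul_assoc] at h
    exact le_of_mul_le_mul_left (by linarith) (Real.exp_pos (Q / 2))
  rw [hW]
  nlinarith [mul_le_mul_of_nonneg_left h3 (sq_nonneg p)]

/-- Khinchine's inequality for the positive part of a linear form. -/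
lemma khinchine_pos_part {n : ℕ} (a : Fin n → ℝ) :
    √(∑ i, a i ^ 2) / 4 ≤ expect fun x => max (∑ i, a i * coord x i) 0 := by
  have h1 := first_moment a 0
  have h2 := second_moment a 0
  have h4 := fourth_moment_le a 0 (by simp)
  simp only [biasedDensity, centeredForm, Pi.zero_apply, zero_mul, add_zero, sub_zero,
    Finset.prod_const_one, one_mul, mul_one, ne_eq, OfNat.ofNat_ne_zero, not_false_eq_true,
    zero_pow] at h1 h2 h4
  set V := ∑ i, a i ^ 2
  have hV : 0 ≤ V := Finset.sum_nonneg fun i _ => sq_nonneg (a i)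
  rcases hV.eq_or_lt with hV | hV
  · rw [← hV]
    simpa using expect_nonneg fun x : Cube n => le_max_right (∑ i, a i * coord x i) 0
  obtain ⟨σ, hσ, hσV⟩ : ∃ σ, 0 < σ ∧ σ ^ 2 = V := ⟨√V, by positivity, Real.sq_sqrt hV.le⟩
  rw [← hσV, Real.sqrt_sq hσ.le]
  rw [← hσV] at h2 h4
  -- The inequality `z ^ 2 - z ^ 4 / 6 ≤ |z| = 2 * max z 0 - z`.
  have pt : ∀ x : Cube n, σ ^ 2 * (∑ i, a i * coord x i) ^ 2 + σ ^ 3 * ∑ i, a i * coord x i ≤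
      1 / 6 * (∑ i, a i * coord x i) ^ 4 + 2 * σ ^ 3 * max (∑ i, a i * coord x i) 0 := by
    intro x
    generalize ∑ i, a i * coord x i = S
    obtain ⟨z, rfl⟩ : ∃ z, S = σ * z := ⟨S / σ, by field_simp⟩
    have hmax : max (σ * z) 0 = σ * max z 0 := by
      rw [mul_max_of_nonneg _ _ hσ.le, mul_zero]
    have cubic : ∀ y : ℝ, 0 ≤ y → y ^ 2 ≤ y ^ 4 / 6 + y := by
      intro y hy
      have : 0 ≤ 1 - y + y ^ 3 / 6 := by
        nlinarith [mul_nonneg hy (sq_nonneg (y - 7 / 5)), sq_nonneg (y - 7 / 5)]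
      nlinarith [mul_nonneg hy this]
    have hq : z ^ 2 + z ≤ 1 / 6 * z ^ 4 + 2 * max z 0 := by
      rcases le_total 0 z with h | h
      · rw [max_eq_left h]
        linarith [cubic z h]
      · rw [max_eq_right h]
        have := cubic (-z) (by linarith)
        rw [neg_sq, Even.neg_pow (by decide)] at this
        linarith
    rw [hmax]
    have := mul_le_mul_of_nonneg_left hq (by positivity : 0 ≤ σ ^ 4)
    linarith
  have := expect_mono pt
  rw [expect_add, expect_add, expect_const_mul, expect_const_mul, expect_const_mul,
    expect_const_mul, h1, h2] at this
  have h : σ ^ 3 * (σ / 4) ≤ σ ^ 3 * expect fun x : Cube n => max (∑ i, a i * coord x i) 0 := by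
    linarith
  exact le_of_mul_le_mul_left h (by positivity)

/-- A Boolean function that is increasing in `∑ aᵢ xᵢ` and supported where this form is positive
has a conditional mean `m` with `|m| ≥ 1 / 4`. -/
lemma level_one_lower_const {n : ℕ} {f : Cube n → ℝ} {a : Fin n → ℝ}
    (hf : ∀ x, f x = 0 ∨ f x = 1)
    (hmono : ∀ x y, ∑ i, a i * coord x i ≤ ∑ i, a i * coord y i → f x ≤ f y)
    (hpos : ∀ x, f x = 1 → 0 < ∑ i, a i * coord x i) :
    expect f ^ 2 / 16 ≤ levelOneWeight f := by
  by_cases hall : ∀ x, f x = 0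
  · have hf0 : f = fun _ => 0 := funext hall
    have h0 : expect f = 0 := by simp [hf0, expect]
    rw [h0]
    simpa [levelOneWeight] using Finset.sum_nonneg fun (i : Fin n) _ => sq_nonneg (fourier f {i})
  obtain ⟨x₀, hx₀⟩ := not_forall.1 hall
  have hf0 : ∀ x, 0 ≤ f x := fun x => by rcases hf x with h | h <;> simp [h]
  have hV : 0 < ∑ i, a i ^ 2 := by
    refine (Finset.sum_nonneg fun i _ => sq_nonneg (a i)).lt_of_ne fun h => ?_
    have hz := (Finset.sum_eq_zero_iff_of_nonneg fun i _ => sq_nonneg (a i)).1 h.symm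
    have hx := hpos x₀ ((hf x₀).resolve_left hx₀)
    refine hx.ne' (Finset.sum_eq_zero fun i hi => ?_)
    rw [pow_eq_zero_iff two_ne_zero |>.1 (hz i hi), zero_mul]
  have hcheb : expect f * expect (fun x => max (∑ i, a i * coord x i) 0) ≤
      expect fun x => f x * ∑ i, a i * coord x i := by
    have hmv : Monovary f fun x => max (∑ i, a i * coord x i) 0 := by
      intro x y hxy
      refine hmono x y (le_of_not_gt fun h => ?_)
      exact absurd (max_le_max_right 0 h.le) (not_le.2 hxy)
    have h := hmv.sum_mul_sum_le_card_mul_sum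
    have e : ∀ x, f x * max (∑ i, a i * coord x i) 0 = f x * ∑ i, a i * coord x i := by
      intro x
      rcases hf x with h | h
      · simp [h]
      · rw [max_eq_left (hpos x h).le]
    simp only [e] at h
    unfold expect
    rw [div_mul_div_comm, div_le_div_iff₀ (by positivity) (by positivity)]
    have hc : (Fintype.card (Cube n) : ℝ) = 2 ^ n := by simp
    rw [hc] at h
    nlinarith [mul_le_mul_of_nonneg_right h (by positivity : (0 : ℝ) ≤ 2 ^ n)]
  rw [expect_mul_linear] at hcheb
  have hk := mul_le_mul_of_nonneg_left (khinchine_pos_part a) (expect_nonneg hf0)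
  have hcs := Finset.sum_mul_sq_le_sq_mul_sq Finset.univ a fun i => fourier f {i}
  have hsq := pow_le_pow_left₀ (mul_nonneg (expect_nonneg hf0) (by positivity))
    (hk.trans hcheb) 2
  rw [mul_pow, div_pow, Real.sq_sqrt hV.le] at hsq
  have := hsq.trans hcs
  refine le_of_mul_le_mul_left ?_ hV
  unfold levelOneWeight
  linarith

/-- A Boolean function that is increasing in `∑ aᵢ xᵢ` has a conditional mean `m` with
`p * exp (4 * |m| ^ 2) ≥ 1 / 81`. -/
lemma level_one_lower_exp {n : ℕ} {f : Cube n → ℝ} {a : Fin n → ℝ}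
    (hf : ∀ x, f x = 0 ∨ f x = 1)
    (hmono : ∀ x y, ∑ i, a i * coord x i ≤ ∑ i, a i * coord y i → f x ≤ f y)
    (hp : 0 < expect f) :
    1 / 81 ≤ expect f * Real.exp (4 * (levelOneWeight f / expect f ^ 2)) := by
  have hf0 : ∀ x, 0 ≤ f x := fun x => by rcases hf x with h | h <;> simp [h]
  have hf1 : ∀ x, f x ≤ 1 := fun x => by rcases hf x with h | h <;> simp [h]
  set p := expect f with hpdef
  let m : Fin n → ℝ := fun i => fourier f {i} / p
  let θ : Fin n → ℝ := fun i => if |m i| < 1 / 2 then m i else if 0 ≤ a i then 1 else -1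
  have hm1 : ∀ i, |m i| ≤ 1 := by
    intro i
    have hc : ∀ x : Cube n, |coord x i| = 1 := fun x => by
      rcases Int.units_eq_one_or (x i) with h | h <;> simp [coord, h]
    simp only [m]
    rw [abs_div, abs_of_pos hp, div_le_one hp, fourier_singleton, abs_le, hpdef]
    have hx : ∀ x : Cube n, |f x * coord x i| ≤ f x := fun x => by
      rw [abs_mul, hc, mul_one, abs_of_nonneg (hf0 x)]
    constructor
    · rw [← neg_one_mul, ← expect_const_mul]
      exact expect_mono fun x => by linarith [(abs_le.1 (hx x)).1]
    · exact expect_mono fun x => (abs_le.1 (hx x)).2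
  have hθ1 : ∀ i, |θ i| ≤ 1 := by
    intro i
    simp only [θ]
    split_ifs
    · exact hm1 i
    · simp
    · simp
  have hθ : ∀ i, (1 - θ i ^ 2) * (1 + 3 * θ i ^ 2) ≤ 3 * (1 - θ i ^ 2) ^ 2 := by
    intro i
    simp only [θ]
    split_ifs with h
    · have h1 : m i ^ 2 ≤ 1 / 4 := by
        rw [← sq_abs]
        nlinarith [abs_nonneg (m i)]
      nlinarith
    · simp
    · simp
  have hθm : ∀ i, θ i ^ 2 ≤ 4 * m i ^ 2 := by
    intro i
    have h4 : ¬|m i| < 1 / 2 → 1 ≤ 4 * m i ^ 2 := fun h => by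
      rw [← sq_abs]
      nlinarith [not_lt.1 h]
    simp only [θ]
    split_ifs with h
    · nlinarith [sq_nonneg (m i)]
    · simpa using h4 h
    · simpa using h4 h
  have haθ : ∑ i, a i * m i ≤ ∑ i, a i * θ i := by
    refine Finset.sum_le_sum fun i _ => ?_
    have h := abs_le.1 (hm1 i)
    simp only [θ]
    split_ifs with h1 h2
    · exact le_rfl
    · nlinarith
    · nlinarith [not_le.1 h2]
  -- Some point of `{f = 1}` lies below the mean of the form on that set.
  obtain ⟨x₀, hx₀, hx₀le⟩ : ∃ x, f x = 1 ∧ ∑ i, a i * coord x i ≤ ∑ i, a i * m i := by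
    by_contra! hcon
    have e : (expect fun x => f x * (∑ i, a i * coord x i - ∑ i, a i * m i)) = 0 := by
      simp only [mul_sub]
      rw [expect_sub, expect_mul_linear]
      simp only [mul_comm (f _)]
      rw [expect_const_mul, ← hpdef, Finset.sum_mul, sub_eq_zero]
      exact Finset.sum_congr rfl fun i _ => by simp only [m]; field_simp
    have hnn : ∀ x, 0 ≤ f x * (∑ i, a i * coord x i - ∑ i, a i * m i) := fun x => by
      rcases hf x with h | h
      · simp [h]
      · rw [h, one_mul]
        linarith [hcon x h]
    have hz := eq_zero_of_expect_eq_zero hnn e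
    have hf00 : f = fun _ => 0 := funext fun x => by
      rcases hf x with h | h
      · exact h
      · have := hz x
        rw [h, one_mul] at this
        linarith [hcon x h]
    rw [hpdef, hf00] at hp
    simp [expect] at hp
  have h9 : 1 / 9 ≤ expect fun x => biasedDensity θ x * f x := by
    refine nonneg_prob a θ hθ1 hθ f hf0 fun x hx => le_antisymm (hf1 x) ?_
    rw [← hx₀]
    refine hmono x₀ x ?_
    simp only [centeredForm, mul_sub, Finset.sum_sub_distrib] at hx
    linarith
  have hcs := expect_cauchy_schwarz (biasedDensity θ) f
  have hff : (fun x => f x ^ 2) = f := funext fun x => by rcases hf x with h | h <;> simp [h]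
  rw [hff, ← hpdef, expect_biasedDensity_sq] at hcs
  have hprod : ∏ i, (1 + θ i ^ 2) ≤ Real.exp (4 * (levelOneWeight f / p ^ 2)) := by
    have e : 4 * (levelOneWeight f / p ^ 2) = ∑ i, 4 * m i ^ 2 := by
      simp only [levelOneWeight, m, Finset.sum_div, Finset.mul_sum, div_pow]
    rw [e, Real.exp_sum]
    refine Finset.prod_le_prod (fun i _ => by positivity) fun i _ => ?_
    linarith [hθm i, Real.add_one_le_exp (4 * m i ^ 2)]
  have h81 := pow_le_pow_left₀ (by norm_num) h9 2
  have := mul_le_mul_of_nonneg_right hprod hp.le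
  linarith

/-! ### Boolean functions and their duals -/

lemma expect_dual {n : ℕ} {f g : Cube n → ℝ} (hg : ∀ x, g x = 1 - f (-x)) :
    expect g = 1 - expect f := by
  rw [funext hg, expect_sub, expect_neg_arg, expect_one]

lemma fourier_dual {n : ℕ} {f g : Cube n → ℝ} (hg : ∀ x, g x = 1 - f (-x)) (i : Fin n) :
    fourier g {i} = fourier f {i} := by
  rw [fourier_singleton, fourier_singleton]
  have h0 : (expect fun x : Cube n => coord x i) = 0 := by
    have h := expect_neg_arg fun x : Cube n => coord x i
    simp only [coord_neg, ← neg_one_mul (coord _ _)] at h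
    rw [expect_const_mul] at h
    linarith
  have e : (fun x => g x * coord x i) = fun x => coord x i + f (-x) * coord (-x) i := by
    funext x
    rw [hg, coord_neg]
    ring
  rw [e, expect_add, h0, zero_add, expect_neg_arg fun x => f x * coord x i]

lemma cov_comm {n : ℕ} (f g : Cube n → ℝ) : cov f g = cov g f := by
  simp only [cov, mul_comm]

/-- From `W ≈ p ^ 2 * (1 + log (1 / p))` to `p ^ 2 ≈ φ W`. -/
lemma talagrandPhi_comparison {p W : ℝ} (hp : 0 < p)
    (hU : W ≤ 2 * p ^ 2 * Real.log (1 / p)) (hC : p ^ 2 / 16 ≤ W)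
    (hE : 1 / 81 ≤ p * Real.exp (4 * (W / p ^ 2))) :
    1 / 2 * talagrandPhi W ≤ p ^ 2 ∧ p ^ 2 ≤ 3000 * talagrandPhi W := by
  have hW : 0 < W := lt_of_lt_of_le (by positivity) hC
  rw [one_div, Real.log_inv] at hU
  set L := -Real.log p with hL
  have hlogW : Real.log (Real.exp 1 / W) = 1 - Real.log W := by
    rw [Real.log_div (Real.exp_pos 1).ne' hW.ne', Real.log_exp]
  have hLp : L ≤ 1 / p - 1 := by
    have := Real.log_le_sub_one_of_pos (inv_pos.2 hp)
    rwa [Real.log_inv, ← one_div] at this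
  have hWp : W ≤ 2 * p * (1 - p) := by
    have := mul_le_mul_of_nonneg_left hLp (by positivity : 0 ≤ 2 * p ^ 2)
    have e : 2 * p ^ 2 * (1 / p - 1) = 2 * p * (1 - p) := by field_simp
    linarith
  have hW1 : Real.log W ≤ 0 := Real.log_nonpos hW.le (by nlinarith [sq_nonneg (2 * p - 1)])
  have hWL : Real.log W ≤ 1 - L := by
    have h := Real.log_le_log hW (by nlinarith [sq_nonneg p] : W ≤ 2 * p)
    rw [Real.log_mul two_ne_zero hp.ne'] at h
    have := Real.log_two_lt_d9
    linarith
  have hlogpos : 0 < 1 - Real.log W := by linarith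
  have hWlow : -Real.log W ≤ 16 + 2 * L := by
    have h := Real.log_le_log (by positivity) hC
    rw [Real.log_div (by positivity) (by norm_num), Real.log_pow] at h
    have := Real.log_le_sub_one_of_pos (by norm_num : (0 : ℝ) < 16)
    push_cast at h
    linarith
  have hLup : L ≤ 81 + 4 * (W / p ^ 2) := by
    have h := Real.log_le_log (by norm_num) hE
    rw [Real.log_mul hp.ne' (Real.exp_pos _).ne', Real.log_exp, one_div, Real.log_inv] at h
    have := Real.log_le_sub_one_of_pos (by norm_num : (0 : ℝ) < 81)
    linarith
  have hLmul : p ^ 2 * L ≤ 81 * p ^ 2 + 4 * W := by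
    have := mul_le_mul_of_nonneg_left hLup (sq_nonneg p)
    have e : p ^ 2 * (81 + 4 * (W / p ^ 2)) = 81 * p ^ 2 + 4 * W := by field_simp
    linarith
  unfold talagrandPhi
  rw [hlogW]
  constructor
  · rw [← mul_div_assoc, div_le_iff₀ hlogpos]
    nlinarith [mul_le_mul_of_nonneg_left (by linarith : L ≤ 1 - Real.log W) (sq_nonneg p)]
  · rw [← mul_div_assoc, le_div_iff₀ hlogpos]
    nlinarith [mul_le_mul_of_nonneg_left hWlow (sq_nonneg p)]

lemma cov_dual_comparison {n : ℕ} {f g : Cube n → ℝ} {a : Fin n → ℝ}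
    (hf : ∀ x, f x = 0 ∨ f x = 1)
    (hmono : ∀ x y, ∑ i, a i * coord x i ≤ ∑ i, a i * coord y i → f x ≤ f y)
    (hpos : ∀ x, f x = 1 → 0 < ∑ i, a i * coord x i) (hg : ∀ x, g x = 1 - f (-x)) :
    1 / 2 * talagrandPhi (∑ i, fourier f {i} * fourier g {i}) ≤ cov f g ∧
      cov f g ≤ 3000 * talagrandPhi (∑ i, fourier f {i} * fourier g {i}) := by
  have hf0 : ∀ x, 0 ≤ f x := fun x => by rcases hf x with h | h <;> simp [h]
  have hsum : ∑ i, fourier f {i} * fourier g {i} = levelOneWeight f :=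
    Finset.sum_congr rfl fun i _ => by rw [fourier_dual hg, sq]
  have hfg : (fun x => f x * g x) = f := by
    funext x
    rcases hf x with h | h
    · simp [h]
    · rw [hg]
      rcases hf (-x) with h' | h'
      · simp [h']
      · have h1 := hpos x h
        have h2 := hpos (-x) h'
        simp only [coord_neg, mul_neg, Finset.sum_neg_distrib] at h2
        linarith
  have hcov : cov f g = expect f ^ 2 := by
    rw [cov, hfg, expect_dual hg]
    ring
  rw [hsum, hcov]
  rcases (expect_nonneg hf0).eq_or_lt with hp | hp
  · have hz : f = fun _ => 0 := funext (eq_zero_of_expect_eq_zero hf0 hp.symm)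
    have hW : levelOneWeight f = 0 := by simp [levelOneWeight, fourier, hz, expect]
    rw [← hp, hW]
    simp [talagrandPhi]
  · exact talagrandPhi_comparison hp (level_one_upper hf hp)
      (level_one_lower_const hf hmono hpos) (level_one_lower_exp hf hmono hp)

/-! ### Halfspaces -/

lemma coord_mono {n : ℕ} {x y : Cube n} (h : x ≤ y) (i : Fin n) : coord x i ≤ coord y i := by
  have : (x i : ℤ) ≤ (y i : ℤ) := h i
  exact Int.cast_le.2 this

lemma halfspace_le_of_le {n : ℕ} {a : Fin n → ℝ} (t : ℝ) {x y : Cube n}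
    (h : ∑ i, a i * coord x i ≤ ∑ i, a i * coord y i) : halfspace a t x ≤ halfspace a t y := by
  unfold halfspace
  split_ifs <;> linarith

lemma dualHalfspace_le_of_le {n : ℕ} {a : Fin n → ℝ} (t : ℝ) {x y : Cube n}
    (h : ∑ i, a i * coord x i ≤ ∑ i, a i * coord y i) :
    dualHalfspace a t x ≤ dualHalfspace a t y := by
  unfold dualHalfspace
  split_ifs <;> linarith

lemma dualHalfspace_eq {n : ℕ} (a : Fin n → ℝ) (t : ℝ) (x : Cube n) :
    dualHalfspace a t x = 1 - halfspace a t (-x) := by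
  simp only [dualHalfspace, halfspace, coord_neg, mul_neg, Finset.sum_neg_distrib]
  split_ifs <;> linarith

lemma halfspace_eq {n : ℕ} (a : Fin n → ℝ) (t : ℝ) (x : Cube n) :
    halfspace a t x = 1 - dualHalfspace a t (-x) := by
  rw [dualHalfspace_eq, neg_neg]
  ring

lemma halfspace_dual_comparison {n : ℕ} (a : Fin n → ℝ) (t : ℝ) :
    1 / 2 * talagrandPhi
        (∑ i, fourier (halfspace a t) {i} * fourier (dualHalfspace a t) {i}) ≤
        cov (halfspace a t) (dualHalfspace a t) ∧
      cov (halfspace a t) (dualHalfspace a t) ≤ 3000 * talagrandPhi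
        (∑ i, fourier (halfspace a t) {i} * fourier (dualHalfspace a t) {i}) := by
  rcases le_or_gt 0 t with ht | ht
  · refine cov_dual_comparison (fun x => ?_) (fun x y => halfspace_le_of_le t) (fun x hx => ?_)
      (dualHalfspace_eq a t)
    · unfold halfspace
      split_ifs <;> simp
    · unfold halfspace at hx
      split_ifs at hx with h
      · linarith
      · simp at hx
  · rw [cov_comm]
    simp only [mul_comm (fourier (halfspace a t) _)]
    refine cov_dual_comparison (fun x => ?_) (fun x y => dualHalfspace_le_of_le t)
      (fun x hx => ?_) (halfspace_eq a t)
    · unfold dualHalfspace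
      split_ifs <;> simp
    · unfold dualHalfspace at hx
      split_ifs at hx with h
      · linarith
      · simp at hx

end BooleanCube

theorem mainTheorem10 :
    (∀ (n : ℕ) (a : Fin n → ℝ) (t : ℝ), (∀ i, 0 ≤ a i) →
      Monotone (BooleanCube.halfspace a t) ∧ Monotone (BooleanCube.dualHalfspace a t)) ∧
    ∃ c C : ℝ, 0 < c ∧ 0 < C ∧ ∀ (n : ℕ) (a : Fin n → ℝ) (t : ℝ),
      c * BooleanCube.talagrandPhi (∑ i : Fin n,
          BooleanCube.fourier (BooleanCube.halfspace a t) {i} *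
          BooleanCube.fourier (BooleanCube.dualHalfspace a t) {i})
        ≤ BooleanCube.cov (BooleanCube.halfspace a t) (BooleanCube.dualHalfspace a t) ∧
      BooleanCube.cov (BooleanCube.halfspace a t) (BooleanCube.dualHalfspace a t)
        ≤ C * BooleanCube.talagrandPhi (∑ i : Fin n,
          BooleanCube.fourier (BooleanCube.halfspace a t) {i} *
          BooleanCube.fourier (BooleanCube.dualHalfspace a t) {i}) := by
  refine ⟨fun n a t ha => ?_, 1 / 2, 3000, by norm_num, by norm_num,
    fun n a t => BooleanCube.halfspace_dual_comparison a t⟩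
  have h : ∀ ⦃x y : BooleanCube.Cube n⦄, x ≤ y →
      ∑ i, a i * BooleanCube.coord x i ≤ ∑ i, a i * BooleanCube.coord y i := fun x y hxy =>
    Finset.sum_le_sum fun i _ => mul_le_mul_of_nonneg_left (BooleanCube.coord_mono hxy i) (ha i)
  exact ⟨fun x y hxy => BooleanCube.halfspace_le_of_le t (h hxy),
    fun x y hxy => BooleanCube.dualHalfspace_le_of_le t (h hxy)⟩
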